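/- **Conventions.** Logarithms are to base 2. Let $\mathcal N=\{1,\dots,N\}$ and let $h:2^{\mathcal N}\to\mathbb R$ satisfy $h(\emptyset)=0$. *Network codes.* A network is a finite directed acyclic graph. A connection requirement on it is a finite set of sessions $s$, each with an originating node $O(s)$ and a set $D(s)$ of receiver nodes. A network code assigns finite nonempty alphabets $\mathcal X_s$, $\mathcal X_e$ to the sessions and edges, and to every edge $e$ a local function that computes the symbol $U_e\in\mathcal X_e$ from the symbols of the sessions originating at the tail of $e$ and of the edges entering the tail of $e$. The source symbols $U_s$ are independent and uniform on $\mathcal X_s$. The code is zero-error if there are decoding functions by which, with error probability $0$, every node $d\in D(s)$ recovers $U_s$ from the symbols on the edges entering $d$, for every $s$. A rate-capacity tuple $(\lambda,\omega)$ is admissible if there is a zero-error network code with $\log|\mathcal X_e|\le\omega_e$ for all edges $e$ and $\log|\mathcal X_s|\ge\lambda_s$ for all sessions $s$. *Quasi-uniformity.* A random variable with finitely many values is quasi-uniform if it is uniformly distributed on its support. $\Gamma^*_Q$ is the set of all functions $\alpha\mapsto H(U_\alpha)$, $\alpha\subseteq\mathcal N$, where $U_1,\dots,U_N$ are jointly distributed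 random variables with finite alphabets such that $U_\alpha=(U_i:i\in\alpha)$ is quasi-uniform for every $\alpha\subseteq\mathcal N$. *The network $G^\dagger$, the requirement $M^\dagger$ and the tuple $T(h)$.* For every nonempty $\alpha\subseteq\mathcal N$ there is a session $S_{[\alpha]}$ with its own source node and with rate $h(\alpha)$. For each $j\in\mathcal N$ an edge $V_j$ of capacity $h(j)$ leads from the source node of $S_{[\mathcal N]}$ to a node $v_j$. The rest consists of the following subnetworks, where edges without a stated capacity are forwarding edges. - Type 0, for each nonempty $\alpha$: an edge of capacity $h(\alpha)$ from the source node of $S_{[\alpha]}$ to a receiver demanding $S_{[\alpha]}$. - Type 1, for each nonempty $\alpha$: an edge of capacity $h(\mathcal N)-h(\alpha)$ from the source node of $S_{[\mathcal N]}$ to a receiver demanding $S_{[\mathcal N]}$; an intermediate node entered by edges from $v_j$, $j\in\alpha$; and an edge of capacity $h(\alpha)$ from the intermediate node to the receiver. - Type 2, for each nonempty $\alpha$ and each $i\in\mathcal N\setminus\alpha$: nodes $a,a',b,b',c,d$, an upper receiver demanding $S_{[\mathcal N]}$ and a lower receiver demanding $S_{[\alpha]}$. Edges from $v_j$, $j\in\alpha$,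 enter $a$. An edge $W^{**}$ of capacity $h(\alpha)$ goes from $a$ to $a'$, and edges go from $a'$ to $b$ and to $c$. An edge goes from the source node of $S_{[\alpha]}$ to $b$ and another one to the upper receiver. An edge $W$ of capacity $h(\alpha)$ goes from $b$ to $b'$, and edges go from $b'$ to both receivers. An edge $W'$ of capacity $h(\mathcal N)-h(\alpha)$ goes from the source node of $S_{[\mathcal N]}$ to the upper receiver. Edges go from $v_i$ to $c$ and to $d$. An edge $W''$ of capacity $h(\alpha\cup\{i\})-h(i)$ goes from $c$ to $d$, and an edge $W^*$ of capacity $h(\alpha)$ goes from $d$ to the lower receiver. All forwarding edges have capacity $\kappa$, for an arbitrary fixed $\kappa\in[\sum_{\alpha}h(\alpha),\infty]$, where $\kappa=\infty$ means that they are uncapacitated. Thus $G^\dagger$ and $M^\dagger$ depend only on $N$, and $h$ enters only through the rates and capacities, which form the tuple $T(h)$. **Theorem.** $T(h)$ is admissible on the network $G^\dagger$ with connection requirement $M^\dagger$ if and only if $h\in\Gamma^*_Q$. -/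

import Mathlib

/-! ## Networks, network codes and admissible rate-capacity tuples -/

/-- A finite directed acyclic graph with node set `Node` and edge set `Edge`;
the edge `e` goes from the node `tail e` to the node `head e`. -/
structure Network where
  Node : Type
  Edge : Type
  finiteNode : Finite Node
  finiteEdge : Finite Edge
  tail : Edge → Node
  head : Edge → Node
  acyclic : ∀ v : Node, ¬ Relation.TransGen (fun u w => ∃ e, tail e = u ∧ head e = w) v v

/-- On a finite acyclic graph, the relation "`f` enters the node that `e` leaves" on the edges
is well-founded. -/
theorem Network.wellFounded (G : Network) :
    WellFounded (fun f e : G.Edge => G.head f = G.tail e) := by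
  have := G.finiteEdge
  let r : G.Edge → G.Edge → Prop := fun f e => G.head f = G.tail e
  have key : ∀ f e, Relation.TransGen r f e →
      Relation.TransGen (fun u w => ∃ e, G.tail e = u ∧ G.head e = w) (G.tail f) (G.tail e) := by
    intro f e h
    induction h with
    | single h => exact Relation.TransGen.single ⟨f, rfl, h⟩
    | tail _ h ih => exact ih.tail ⟨_, rfl, h⟩
  have : Std.Irrefl (Relation.TransGen r) := ⟨fun e h => G.acyclic _ (key e e h)⟩
  have : IsTrans G.Edge (Relation.TransGen r) := ⟨fun _ _ _ h k => h.trans k⟩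
  have wf : WellFounded (Relation.TransGen r) := Finite.wellFounded_of_trans_of_irrefl _
  exact Subrelation.wf (r := Relation.TransGen r) (fun h => Relation.TransGen.single h) wf

/-- A connection requirement on a network: the multicast sessions, the node `origin s` at which the
source of session `s` is located, and the set `receivers s` of nodes that demand it. -/
structure ConnectionRequirement (G : Network) where
  Session : Type
  finiteSession : Finite Session
  origin : Session → G.Node
  receivers : Session → Set G.Node

/-- A network code: finite nonempty alphabets for the sources and the edges and, for every edge `e`,
a local coding function of the symbols of the sources located at the tail of `e` and of the edges
that enter the tail of `e`. -/
structure NetworkCode (G : Network) (M : ConnectionRequirement G) where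
  srcAlphabet : M.Session → Type
  edgeAlphabet : G.Edge → Type
  finiteSrc : ∀ s, Finite (srcAlphabet s)
  nonemptySrc : ∀ s, Nonempty (srcAlphabet s)
  finiteEdge : ∀ e, Finite (edgeAlphabet e)
  nonemptyEdge : ∀ e, Nonempty (edgeAlphabet e)
  localFun : ∀ e : G.Edge,
    ((s : {s : M.Session // M.origin s = G.tail e}) → srcAlphabet s.1) →
    ((f : {f : G.Edge // G.head f = G.tail e}) → edgeAlphabet f.1) → edgeAlphabet e

namespace NetworkCode

variable {G : Network} {M : ConnectionRequirement G}

/-- The tuples of source symbols. The sources are independent and uniformly distributed over their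
alphabets, that is, the tuple of source symbols is uniformly distributed over this finite set. -/
abbrev Messages (Φ : NetworkCode G M) : Type := (s : M.Session) → Φ.srcAlphabet s

/-- The symbol transmitted on the edge `e` when the source symbols are `x`. -/
noncomputable def linkSymbol (Φ : NetworkCode G M) (x : Φ.Messages) :
    (e : G.Edge) → Φ.edgeAlphabet e :=
  G.wellFounded.fix fun e U => Φ.localFun e (fun s => x s.1) (fun f => U f.1 f.2)

/-- Every edge transmits its local coding function applied to the incident symbols. -/
theorem linkSymbol_eq (Φ : NetworkCode G M) (x : Φ.Messages) (e : G.Edge) :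
    Φ.linkSymbol x e =
      Φ.localFun e (fun s => x s.1) (fun f => Φ.linkSymbol x f.1) :=
  G.wellFounded.fix_eq _ e

/-- A choice of decoding functions: the node `d` estimates the source symbol of session `s` from
the symbols on the edges that enter `d`. -/
abbrev Decoder (Φ : NetworkCode G M) : Type :=
  (s : M.Session) → (d : G.Node) →
    ((f : {f : G.Edge // G.head f = d}) → Φ.edgeAlphabet f.1) → Φ.srcAlphabet s

/-- The probability that at least one receiver fails to reconstruct a source message it demands. -/
noncomputable def errorProb (Φ : NetworkCode G M) (δ : Φ.Decoder) : ℝ :=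
  (Nat.card {x : Φ.Messages // ∃ s, ∃ d ∈ M.receivers s,
      δ s d (fun f => Φ.linkSymbol x f.1) ≠ x s} : ℝ) / (Nat.card Φ.Messages : ℝ)

/-- A zero-error network code: with suitable decoding functions the error probability is zero. -/
def IsZeroError (Φ : NetworkCode G M) : Prop := ∃ δ : Φ.Decoder, Φ.errorProb δ = 0

end NetworkCode

/-- Admissibility of the rate-capacity tuple `(rate, cap)`: a zero-error network code exists such
that `log |X_e| ≤ cap e` for every edge and `log |X_s| ≥ rate s` for every session. Capacities
are extended reals, `⊤` being the capacity of an uncapacitated edge. Logarithms are to base 2. -/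
def IsAdmissible (G : Network) (M : ConnectionRequirement G)
    (rate : M.Session → ℝ) (cap : G.Edge → EReal) : Prop :=
  ∃ Φ : NetworkCode G M, Φ.IsZeroError ∧
    (∀ e, ((Real.logb 2 (Nat.card (Φ.edgeAlphabet e)) : ℝ) : EReal) ≤ cap e) ∧
    (∀ s, rate s ≤ Real.logb 2 (Nat.card (Φ.srcAlphabet s)))

/-! ## Quasi-uniform random variables -/

section QuasiUniform

open MeasureTheory

/-- The distribution `b ↦ Pr(X = b)`. -/
noncomputable def probOf {Ω B : Type} [MeasurableSpace Ω] (μ : Measure Ω) (X : Ω → B) (b : B) : ℝ :=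
  μ.real (X ⁻¹' {b})

/-- The support of a discrete random variable. -/
def rvSupport {Ω B : Type} [MeasurableSpace Ω] (μ : Measure Ω) (X : Ω → B) : Set B :=
  {b | probOf μ X b ≠ 0}

/-- The Shannon entropy, in bits, of a random variable with finitely many values. -/
noncomputable def shannonEntropy {Ω B : Type} [MeasurableSpace Ω] (μ : Measure Ω) (X : Ω → B) : ℝ :=
  ∑ᶠ b, -(probOf μ X b * Real.logb 2 (probOf μ X b))

/-- A random variable is quasi-uniform if it is uniformly distributed over its support. -/
def IsQuasiUniform {Ω B : Type} [MeasurableSpace Ω] (μ : Measure Ω) (X : Ω → B) : Prop :=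
  ∀ b ∈ rvSupport μ X, probOf μ X b = 1 / ((rvSupport μ X).ncard : ℝ)

/-- The joint random variable `U_α = (U_i : i ∈ α)`. -/
def jointRV {Ω : Type} {N : ℕ} {A : Fin N → Type} (U : (i : Fin N) → Ω → A i)
    (α : Finset (Fin N)) (ω : Ω) : (i : α) → A i.1 :=
  fun i => U i.1 ω

/-- The set of quasi-uniform entropy functions of `N` random variables: `h(α) = H(U_α)` for
all `α`, for some random variables `U_1, …, U_N` with finite alphabets on a probability space such
that every `U_α` is quasi-uniform. -/
def quasiUniformEntropyFunctions (N : ℕ) : Set (Finset (Fin N) → ℝ) :=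
  {h | ∃ (Ω : Type) (_ : MeasurableSpace Ω) (μ : Measure Ω) (A : Fin N → Type)
      (U : (i : Fin N) → Ω → A i),
      IsProbabilityMeasure μ ∧ (∀ i, Finite (A i)) ∧ (∀ i, Measurable[_, ⊤] (U i)) ∧
      (∀ α, IsQuasiUniform μ (jointRV U α)) ∧
      ∀ α, h α = shannonEntropy μ (jointRV U α)}

end QuasiUniform

/-! ## The network `G†`, the connection requirement `M†` and the tuple `T(h)` -/

namespace Dagger

/-- The nonempty subsets of the ground set. -/
abbrev NE (N : ℕ) : Type := {α : Finset (Fin N) // α.Nonempty}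

/-- The index set of the type 2 subnetworks: a nonempty set `α` and an element `i ∉ α`. -/
abbrev Pairs (N : ℕ) : Type := {p : Finset (Fin N) × Fin N // p.1.Nonempty ∧ p.2 ∉ p.1}

/-- The set `α` of a type 2 index. -/
def Pairs.set {N : ℕ} (p : Pairs N) : NE N := ⟨p.1.1, p.2.1⟩

/-- The element `i` of a type 2 index. -/
def Pairs.elt {N : ℕ} (p : Pairs N) : Fin N := p.1.2

/-- The whole ground set, which is nonempty as soon as it has a nonempty subset. -/
def NE.top {N : ℕ} (α : NE N) : NE N := ⟨Finset.univ, α.2.mono (Finset.subset_univ _)⟩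

/-- The nodes of `G†`. -/
inductive Node (N : ℕ) : Type
  /-- the node where the source `S_[α]` is located -/
  | source (α : NE N)
  /-- the node that receives `V_j` from `S_[N]` and duplicates it -/
  | dup (j : Fin N)
  /-- type 0: the receiver, which demands `S_[α]` -/
  | sink0 (α : NE N)
  /-- type 1: the intermediate node -/
  | mid1 (α : NE N)
  /-- type 1: the receiver, which demands `S_[N]` -/
  | sink1 (α : NE N)
  /-- type 2: the node that collects `V_α` and sends `W**` -/
  | collect (p : Pairs N)
  /-- type 2: the node that duplicates `W**` -/
  | copy (p : Pairs N)
  /-- type 2: the node that combines `W**` and `S_[α]` into `W` -/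
  | mix (p : Pairs N)
  /-- type 2: the node that duplicates `W` -/
  | fork (p : Pairs N)
  /-- type 2: the node that compresses `W**`, given `V_i`, into `W''` -/
  | compress (p : Pairs N)
  /-- type 2: the node that forms `W*` from `W''` and `V_i` -/
  | expand (p : Pairs N)
  /-- type 2: the upper receiver, which demands `S_[N]` -/
  | upper (p : Pairs N)
  /-- type 2: the lower receiver, which demands `S_[α]` -/
  | lower (p : Pairs N)
  deriving Fintype

set_option synthInstance.maxSize 1000 in
set_option synthInstance.maxHeartbeats 200000 in
/-- The edges of `G†`. -/
inductive Edge (N : ℕ) : Type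
  /-- the edge `V_j` out of `S_[N]` -/
  | V (j : Fin N)
  /-- type 0: the edge `W` -/
  | W0 (α : NE N)
  /-- type 1: the edge `W` from `S_[N]` to the receiver -/
  | W1 (α : NE N)
  /-- type 1: the edge that brings `V_j`, `j ∈ α`, to the intermediate node -/
  | in1 (α : NE N) (j : α.1)
  /-- type 1: the edge `W'` from the intermediate node to the receiver -/
  | W1' (α : NE N)
  /-- type 2: the edge that brings `V_j`, `j ∈ α`, to the collecting node -/
  | in2 (p : Pairs N) (j : p.set.1)
  /-- type 2: the edge `W**` -/
  | Wss (p : Pairs N)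
  /-- type 2: a copy of `W**` for the node that forms `W` -/
  | copyMix (p : Pairs N)
  /-- type 2: a copy of `W**` for the node that forms `W''` -/
  | copyCompress (p : Pairs N)
  /-- type 2: the edge that brings `S_[α]` to the node that forms `W` -/
  | srcMix (p : Pairs N)
  /-- type 2: the edge that brings `S_[α]` to the upper receiver -/
  | srcUpper (p : Pairs N)
  /-- type 2: the edge `W` -/
  | W (p : Pairs N)
  /-- type 2: a copy of `W` for the upper receiver -/
  | forkUpper (p : Pairs N)
  /-- type 2: a copy of `W` for the lower receiver -/
  | forkLower (p : Pairs N)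
  /-- type 2: the edge `W'` from `S_[N]` to the upper receiver -/
  | W' (p : Pairs N)
  /-- type 2: the first copy of `V_i` -/
  | viCompress (p : Pairs N)
  /-- type 2: the second copy of `V_i` -/
  | viExpand (p : Pairs N)
  /-- type 2: the edge `W''` -/
  | W'' (p : Pairs N)
  /-- type 2: the edge `W*` to the lower receiver -/
  | Ws (p : Pairs N)
  deriving Fintype

/-- The node that an edge leaves. -/
def tail {N : ℕ} : Edge N → Node N
  | .V j => .source (NE.top ⟨{j}, Finset.singleton_nonempty j⟩)
  | .W0 α => .source α
  | .W1 α => .source α.top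
  | .in1 _ j => .dup j.1
  | .W1' α => .mid1 α
  | .in2 _ j => .dup j.1
  | .Wss p => .collect p
  | .copyMix p => .copy p
  | .copyCompress p => .copy p
  | .srcMix p => .source p.set
  | .srcUpper p => .source p.set
  | .W p => .mix p
  | .forkUpper p => .fork p
  | .forkLower p => .fork p
  | .W' p => .source p.set.top
  | .viCompress p => .dup p.elt
  | .viExpand p => .dup p.elt
  | .W'' p => .compress p
  | .Ws p => .expand p

/-- The node that an edge enters. -/
def head {N : ℕ} : Edge N → Node N
  | .V j => .dup j
  | .W0 α => .sink0 α
  | .W1 α => .sink1 α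
  | .in1 α _ => .mid1 α
  | .W1' α => .sink1 α
  | .in2 p _ => .collect p
  | .Wss p => .copy p
  | .copyMix p => .mix p
  | .copyCompress p => .compress p
  | .srcMix p => .mix p
  | .srcUpper p => .upper p
  | .W p => .fork p
  | .forkUpper p => .upper p
  | .forkLower p => .lower p
  | .W' p => .upper p
  | .viCompress p => .compress p
  | .viExpand p => .expand p
  | .W'' p => .expand p
  | .Ws p => .lower p

/-- A topological order, used only to check that the graph is acyclic. -/
def depth {N : ℕ} : Node N → ℕ
  | .source _ => 0
  | .dup _ => 1
  | .mid1 _ => 2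
  | .collect _ => 2
  | .copy _ => 3
  | .mix _ => 4
  | .compress _ => 4
  | .fork _ => 5
  | .expand _ => 5
  | .sink0 _ => 6
  | .sink1 _ => 6
  | .upper _ => 6
  | .lower _ => 6

theorem depth_lt {N : ℕ} (e : Edge N) : depth (tail e) < depth (head e) := by
  cases e <;> simp [tail, head, depth]

/-- The receivers that demand the session `S_[α]`. -/
def receivers {N : ℕ} (α : NE N) : Set (Node N) :=
  {v | v = .sink0 α ∨ (∃ p : Pairs N, p.set = α ∧ v = .lower p) ∨
    (α.1 = Finset.univ ∧ ((∃ β : NE N, v = .sink1 β) ∨ ∃ p : Pairs N, v = .upper p))}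

end Dagger

/-- The network `G†`; it depends only on `N`. -/
def daggerNetwork (N : ℕ) : Network where
  Node := Dagger.Node N
  Edge := Dagger.Edge N
  finiteNode := inferInstance
  finiteEdge := inferInstance
  tail := Dagger.tail
  head := Dagger.head
  acyclic := by
    intro v h
    have key : ∀ u w : Dagger.Node N,
        Relation.TransGen (fun u w => ∃ e, Dagger.tail e = u ∧ Dagger.head e = w) u w →
        Dagger.depth u < Dagger.depth w := by
      intro u w h
      induction h with
      | single h => obtain ⟨e, rfl, rfl⟩ := h; exact Dagger.depth_lt e
      | tail _ h ih => obtain ⟨e, rfl, rfl⟩ := h; exact ih.trans (Dagger.depth_lt e)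
    exact lt_irrefl _ (key v v h)

/-- The connection requirement `M†`, with one session for every nonempty subset of the ground set;
it depends only on `N`. -/
def daggerRequirement (N : ℕ) : ConnectionRequirement (daggerNetwork N) where
  Session := Dagger.NE N
  finiteSession := inferInstance
  origin := Dagger.Node.source
  receivers := Dagger.receivers

/-- The source rates of the tuple `T(h)`. -/
def inducedRate {N : ℕ} (h : Finset (Fin N) → ℝ) : (daggerRequirement N).Session → ℝ :=
  fun α : Dagger.NE N => h α.1

/-- The link capacities of the tuple `T(h)`; `κ` is the capacity of the edges that only forward
what they receive (`κ = ⊤` if these edges are uncapacitated). -/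
def inducedCapacity {N : ℕ} (κ : EReal) (h : Finset (Fin N) → ℝ) :
    (daggerNetwork N).Edge → EReal :=
  fun e : Dagger.Edge N => match e with
  | .V j => (h {j} : ℝ)
  | .W0 α => (h α.1 : ℝ)
  | .W1 α => (h Finset.univ - h α.1 : ℝ)
  | .W1' α => (h α.1 : ℝ)
  | .Wss p => (h p.set.1 : ℝ)
  | .W p => (h p.set.1 : ℝ)
  | .W' p => (h Finset.univ - h p.set.1 : ℝ)
  | .W'' p => (h (insert p.elt p.set.1) - h {p.elt} : ℝ)
  | .Ws p => (h p.set.1 : ℝ)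
  | .in1 _ _ => κ
  | .in2 _ _ => κ
  | .copyMix _ => κ
  | .copyCompress _ => κ
  | .srcMix _ => κ
  | .srcUpper _ => κ
  | .forkUpper _ => κ
  | .forkLower _ => κ
  | .viCompress _ => κ
  | .viExpand _ => κ

/-! Both sides are equivalent to a counting statement, `IsUniformFamily`: there are maps V_i on a
finite set Ω such that, for every α, each nonempty fibre of V_α has |Ω| / 2^h(α) elements. A
quasi-uniform vector gives such a family on the support of its joint law; conversely, a uniform
point of Ω makes the V_i quasi-uniform with entropies h.

From a family to a code: S_[α] ranges over the 2^h(α) values of V_α, and S_[N] names a value of the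
whole vector. Equal fibres mean that exactly 2^(h(β) - h(α)) indices describe V_β given V_α when α ⊆
β, which is what W' and W'' can carry. W is V_α masked by S_[α] with a group operation.

From a code to a family: let Ω be the alphabet of S_[N], freeze the other sources, and let V_j be
the symbol on the edge V_j. Type 0 and the rate force |Ω| = 2^h(N). By type 1, V_α and an index with
at most 2^(h(N) - h(α)) values determine the message, so no fibre of V_α is larger than that. If V_α
also has at most 2^h(α) values, these bounds multiply to |Ω| and every fibre has exactly the extreme
size.

The bound on the number of values is proved by adding one element i at a time
(`card_range_jointRV_le`). The type 2 subnetwork forces (V_i, W'') to determine V_α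
(`eq_of_masked_eq`), so V_{α ∪ {i}} has at most 2^h(i) · 2^(h(α ∪ {i}) - h(i)) values. -/

/-! ### Quasi-uniform vectors as maps with equal fibres -/

/-- The entropy of a quasi-uniform random variable is the logarithm of the size of its support. -/
theorem shannonEntropy_of_isQuasiUniform {Ω B : Type} [MeasurableSpace Ω]
    {μ : MeasureTheory.Measure Ω} {X : Ω → B} [Finite B] (hX : IsQuasiUniform μ X) :
    shannonEntropy μ X = Real.logb 2 (rvSupport μ X).ncard := by
  classical
  have := Fintype.ofFinite B
  rw [shannonEntropy, finsum_eq_sum_of_fintype]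
  -- The measure is arbitrary, so the support may be empty; both sides are then 0, because
  -- `Real.logb 2 0 = 0`.
  rcases Set.eq_empty_or_nonempty (rvSupport μ X) with h0 | hne
  · rw [h0, Set.ncard_empty, Nat.cast_zero, Real.logb_zero]
    refine Finset.sum_eq_zero fun b _ => ?_
    have : b ∉ rvSupport μ X := by simp [h0]
    simp only [rvSupport, Set.mem_ofPred_eq, not_not] at this
    simp [this]
  have hpos : ((rvSupport μ X).ncard : ℝ) ≠ 0 := by
    exact_mod_cast ((Set.ncard_pos (Set.toFinite _)).2 hne).ne'
  have key : ∀ b, -(probOf μ X b * Real.logb 2 (probOf μ X b)) =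
      if b ∈ rvSupport μ X then
        Real.logb 2 (rvSupport μ X).ncard / ((rvSupport μ X).ncard : ℝ) else 0 := by
    intro b
    split_ifs with hb
    · rw [hX b hb, one_div, Real.logb_inv]
      ring
    · simp only [rvSupport, Set.mem_ofPred_eq, not_not] at hb
      simp [hb]
  rw [Finset.sum_congr rfl fun b _ => key b, ← Finset.sum_filter, Finset.sum_const,
    Set.ncard_eq_toFinset_card', nsmul_eq_mul]
  have : Finset.univ.filter (fun b => b ∈ rvSupport μ X) = (rvSupport μ X).toFinset := by
    ext; simp
  rw [this]
  rw [Set.ncard_eq_toFinset_card'] at hpos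
  field_simp

/-- A family of maps on a finite set such that, for every `α`, all the nonempty fibres of the joint
map indexed by `α` have the same size, namely the fraction `2 ^ (-h α)` of the whole set. -/
def IsUniformFamily {N : ℕ} {Ω : Type} {A : Fin N → Type} (V : (i : Fin N) → Ω → A i)
    (h : Finset (Fin N) → ℝ) : Prop :=
  ∀ α x, (Nat.card {y // jointRV V α y = jointRV V α x} : ℝ) * 2 ^ h α = Nat.card Ω

/-- The number of values of a map on a finite set all of whose fibres have `q` elements. -/
theorem card_range_mul_of_card_fiber {Ω B : Type} [Finite Ω] (f : Ω → B) (q : ℝ)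
    (hf : ∀ x, (Nat.card {y // f y = f x} : ℝ) = q) :
    (Nat.card (Set.range f) : ℝ) * q = Nat.card Ω := by
  classical
  have := Fintype.ofFinite Ω
  have := Fintype.ofFinite (Set.range f)
  rw [← Nat.card_congr (Equiv.sigmaFiberEquiv (Set.rangeFactorization f)), Nat.card_sigma,
    Nat.cast_sum, Finset.sum_congr rfl (g := fun _ => q)]
  · simp [Nat.card_eq_fintype_card]
  · rintro ⟨_, x, rfl⟩ _
    rw [← hf x]
    congr 1
    exact Nat.card_congr (Equiv.subtypeEquivRight fun y => Subtype.ext_iff)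

theorem IsUniformFamily.card_range {N : ℕ} {Ω : Type} [Finite Ω] [Nonempty Ω]
    {A : Fin N → Type} {V : (i : Fin N) → Ω → A i} {h : Finset (Fin N) → ℝ}
    (hV : IsUniformFamily V h) (α : Finset (Fin N)) :
    (Nat.card (Set.range (jointRV V α)) : ℝ) = 2 ^ h α := by
  have h2 : (0 : ℝ) < 2 ^ h α := by positivity
  have hc : (Nat.card Ω : ℝ) ≠ 0 := by exact_mod_cast Nat.card_pos.ne'
  have := card_range_mul_of_card_fiber (jointRV V α) (Nat.card Ω / 2 ^ h α)
    fun x => by rw [← hV α x]; field_simp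
  field_simp at this
  exact this

theorem measureReal_uniformOn_univ {Ω : Type} [Finite Ω] [MeasurableSpace Ω]
    [MeasurableSingletonClass Ω] (p : Ω → Prop) :
    (ProbabilityTheory.uniformOn (Set.univ : Set Ω)).real {x | p x} =
      (Nat.card {x // p x} : ℝ) / Nat.card Ω := by
  classical
  have := Fintype.ofFinite Ω
  rw [MeasureTheory.measureReal_def, ProbabilityTheory.uniformOn_univ,
    MeasureTheory.Measure.count_apply (Set.toFinite _).measurableSet]
  rw [ENNReal.toReal_div]
  congr 1
  · rw [Set.encard, ENat.card_eq_coe_natCard]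
    exact congrArg _ rfl
  · simp

/-- Under the uniform law on Ω the support of V_α is its range, and equal fibres give each of its
2^h(α) values the probability 2^(-h(α)). -/
theorem IsUniformFamily.mem_quasiUniformEntropyFunctions {N : ℕ} {Ω : Type} [Finite Ω] [Nonempty Ω]
    {A : Fin N → Type} [∀ i, Finite (A i)] {V : (i : Fin N) → Ω → A i} {h : Finset (Fin N) → ℝ}
    (hV : IsUniformFamily V h) : h ∈ quasiUniformEntropyFunctions N := by
  let _ : MeasurableSpace Ω := ⊤
  have hc : (Nat.card Ω : ℝ) ≠ 0 := by exact_mod_cast Nat.card_pos.ne'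
  have hprob : ∀ α x, probOf (ProbabilityTheory.uniformOn Set.univ) (jointRV V α)
      (jointRV V α x) = 1 / 2 ^ h α := by
    intro α x
    have h2 : (0 : ℝ) < 2 ^ h α := by positivity
    have := hV α x
    rw [probOf]
    refine (measureReal_uniformOn_univ fun y => jointRV V α y = jointRV V α x).trans ?_
    field_simp
    exact this
  have hsupp : ∀ α, rvSupport (ProbabilityTheory.uniformOn Set.univ) (jointRV V α) =
      Set.range (jointRV V α) := by
    intro α
    ext b
    constructor
    · intro hb
      by_contra hn
      refine hb ?_
      have : jointRV V α ⁻¹' {b} = ∅ := by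
        ext y
        simp only [Set.mem_preimage, Set.mem_singleton_iff, Set.mem_empty_iff_false, iff_false]
        exact fun hy => hn ⟨y, hy⟩
      simp [probOf, this]
    · rintro ⟨x, rfl⟩
      have : (0 : ℝ) < 1 / 2 ^ h α := by positivity
      exact (hprob α x).trans_ne this.ne'
  have hcard : ∀ α, ((rvSupport (ProbabilityTheory.uniformOn Set.univ) (jointRV V α)).ncard : ℝ) =
      2 ^ h α := by
    intro α
    rw [hsupp, ← hV.card_range α]
    rfl
  have hqu : ∀ α, IsQuasiUniform (ProbabilityTheory.uniformOn Set.univ) (jointRV V α) := by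
    intro α b hb
    rw [hcard]
    rw [hsupp] at hb
    obtain ⟨x, rfl⟩ := hb
    exact hprob α x
  refine ⟨Ω, ⊤, ProbabilityTheory.uniformOn Set.univ, A, V, inferInstance, inferInstance,
    fun i => fun _ _ => trivial, hqu, fun α => ?_⟩
  rw [shannonEntropy_of_isQuasiUniform (hqu α), hcard, Real.logb_rpow] <;> norm_num

/-- Take Ω to be the support of the full vector, with the coordinate projections. Quasi-uniformity
of the full vector turns probabilities of U_α into proportions of Ω; quasi-uniformity of U_α makes
these proportions equal. -/
theorem exists_isUniformFamily {N : ℕ} {h : Finset (Fin N) → ℝ}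
    (hh : h ∈ quasiUniformEntropyFunctions N) :
    ∃ (Ω : Type) (A : Fin N → Type) (V : (i : Fin N) → Ω → A i),
      Finite Ω ∧ Nonempty Ω ∧ IsUniformFamily V h := by
  classical
  obtain ⟨Ω, _, μ, A, U, _, hA, hU, hqu, hent⟩ := hh
  have hmeas : ∀ α b, MeasurableSet (jointRV U α ⁻¹' {b}) := by
    intro α b
    have : jointRV U α ⁻¹' {b} = ⋂ i : α, U i ⁻¹' {b i} := by
      ext ω
      simp [jointRV, funext_iff]
    rw [this]
    exact MeasurableSet.iInter fun i => hU i trivial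
  have hFA := fun i => Fintype.ofFinite (A i)
  let S := rvSupport μ (jointRV U Finset.univ)
  have hmarg : ∀ (α : Finset (Fin N)) (b : (i : α) → A i), probOf μ (jointRV U α) b =
      (Nat.card {y : S // (fun i : α => y.1 ⟨i, Finset.mem_univ _⟩) = b} : ℝ) / S.ncard := by
    intro α b
    have hset : jointRV U α ⁻¹' {b} = ⋃ y ∈ Finset.univ.filter
        (fun y : (i : (Finset.univ : Finset (Fin N))) → A i =>
          (fun i : α => y ⟨i, Finset.mem_univ _⟩) = b), jointRV U Finset.univ ⁻¹' {y} := by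
      ext ω
      simp [jointRV]
      exact Iff.rfl
    rw [probOf, hset, MeasureTheory.measureReal_biUnion_finset]
    · have hval : ∀ y, μ.real (jointRV U Finset.univ ⁻¹' {y}) =
          if y ∈ S then 1 / (S.ncard : ℝ) else 0 := by
        intro y
        split_ifs with hy
        · exact hqu _ y hy
        · exact not_not.1 hy
      rw [Finset.sum_congr rfl fun y _ => hval y, ← Finset.sum_filter, Finset.sum_const,
        nsmul_eq_mul, mul_one_div]
      congr 2
      rw [Finset.filter_filter, ← Fintype.card_subtype, ← Nat.card_eq_fintype_card]
      exact Nat.card_congr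
        { toFun := fun y => ⟨⟨y.1, y.2.2⟩, y.2.1⟩
          invFun := fun y => ⟨y.1.1, y.2, y.1.2⟩
          left_inv := fun _ => rfl
          right_inv := fun _ => rfl }
    · intro y _ z _ hyz
      exact Disjoint.preimage _ (by simpa using hyz)
    · exact fun y _ => hmeas _ y
  -- For an empty support the marginal formula at α = ∅ would read 1 = x / 0 = 0.
  have hsum : ∃ y, y ∈ S := by
    by_contra! hn
    have h0 := hmarg ∅ (fun i => (Finset.notMem_empty _ i.2).elim)
    have : S.ncard = 0 := by rw [Set.eq_empty_of_forall_notMem hn, Set.ncard_empty]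
    rw [this, Nat.cast_zero, div_zero, probOf] at h0
    have h1 : jointRV U ∅ ⁻¹' {fun i => (Finset.notMem_empty _ i.2).elim} = Set.univ := by
      ext ω
      simp only [Set.mem_preimage, Set.mem_singleton_iff, Set.mem_univ, iff_true]
      funext i
      exact (Finset.notMem_empty _ i.2).elim
    rw [h1] at h0
    simp at h0
  have hS0 : (S.ncard : ℝ) ≠ 0 := by
    exact_mod_cast ((Set.ncard_pos (Set.toFinite _)).2 hsum).ne'
  refine ⟨S, A, fun i y => y.1 ⟨i, Finset.mem_univ _⟩, inferInstance, ⟨⟨hsum.choose, hsum.choose_spec⟩⟩, ?_⟩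
  intro α x
  have hm := hmarg α (fun i => x.1 ⟨i, Finset.mem_univ _⟩)
  set b : (i : α) → A i := fun i => x.1 ⟨i, Finset.mem_univ _⟩
  have hfib : (Nat.card {y : S // (fun i : α => y.1 ⟨i, Finset.mem_univ _⟩) = b} : ℝ) ≠ 0 := by
    have : Nonempty {y : S // (fun i : α => y.1 ⟨i, Finset.mem_univ _⟩) = b} := ⟨⟨x, rfl⟩⟩
    exact_mod_cast Nat.card_pos.ne'
  have hb : b ∈ rvSupport μ (jointRV U α) := by
    change probOf _ _ _ ≠ 0
    rw [hm]
    exact div_ne_zero hfib hS0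
  have hn0 : ((rvSupport μ (jointRV U α)).ncard : ℝ) ≠ 0 := by
    exact_mod_cast ((Set.ncard_pos (Set.toFinite _)).2 ⟨b, hb⟩).ne'
  rw [hqu α b hb] at hm
  rw [hent α, shannonEntropy_of_isQuasiUniform (hqu α),
    Real.rpow_logb (by norm_num) (by norm_num) (by positivity)]
  change (Nat.card {y : S // (fun i : α => y.1 ⟨i, Finset.mem_univ _⟩) = b} : ℝ) * _ = S.ncard
  field_simp at hm
  linarith

/-! ### Codes described by which symbols determine which -/

namespace NetworkCode

variable {G : Network} {M : ConnectionRequirement G}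

/-- The symbol on an edge is determined by the incident symbols. -/
theorem linkSymbol_congr (Φ : NetworkCode G M) {x y : Φ.Messages} {e : G.Edge}
    (hs : ∀ s, M.origin s = G.tail e → x s = y s)
    (hf : ∀ f, G.head f = G.tail e → Φ.linkSymbol x f = Φ.linkSymbol y f) :
    Φ.linkSymbol x e = Φ.linkSymbol y e := by
  rw [linkSymbol_eq, linkSymbol_eq Φ y]
  congr 1
  · funext s
    exact hs s.1 s.2
  · funext f
    exact hf f.1 f.2

/-- In a zero-error code a receiver can tell apart any two values of a message it demands. -/
theorem IsZeroError.eq_of_linkSymbol_eq {Φ : NetworkCode G M} (h : Φ.IsZeroError)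
    {x y : Φ.Messages} {s : M.Session} {d : G.Node} (hd : d ∈ M.receivers s)
    (hf : ∀ f, G.head f = d → Φ.linkSymbol x f = Φ.linkSymbol y f) : x s = y s := by
  obtain ⟨δ, hδ⟩ := h
  have := M.finiteSession
  have := Φ.finiteSrc
  have := Φ.nonemptySrc
  have hδ' : ∀ x : Φ.Messages, δ s d (fun f => Φ.linkSymbol x f.1) = x s := by
    intro x
    by_contra hx
    -- A quotient is also 0 when its denominator is; finite nonempty alphabets rule this out.
    rw [errorProb, div_eq_zero_iff] at hδ
    have : Nonempty {x : Φ.Messages // ∃ s, ∃ d ∈ M.receivers s,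
      δ s d (fun f => Φ.linkSymbol x f.1) ≠ x s} := ⟨⟨x, s, d, hd, hx⟩⟩
    rcases hδ with h0 | h0
    · exact Nat.card_pos.ne' (Nat.cast_eq_zero.1 h0)
    · exact Nat.card_pos.ne' (Nat.cast_eq_zero.1 h0)
  rw [← hδ' x, ← hδ' y]
  congr 1
  funext f
  exact hf f.1 f.2

end NetworkCode

/-- A network code may be given by the symbols on the edges as functions of the messages, provided
that these are determined by the incident symbols. -/
theorem isAdmissible_of_globalFun {G : Network} {M : ConnectionRequirement G}
    {rate : M.Session → ℝ} {cap : G.Edge → EReal}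
    (S : M.Session → Type) (E : G.Edge → Type) [∀ s, Finite (S s)] [∀ s, Nonempty (S s)]
    [∀ e, Finite (E e)] [∀ e, Nonempty (E e)] (F : (e : G.Edge) → ((s : M.Session) → S s) → E e)
    (hF : ∀ e x y, (∀ s, M.origin s = G.tail e → x s = y s) →
      (∀ f, G.head f = G.tail e → F f x = F f y) → F e x = F e y)
    (hdec : ∀ s, ∀ d ∈ M.receivers s, ∀ x y, (∀ f, G.head f = d → F f x = F f y) → x s = y s)
    (hcap : ∀ e, ((Real.logb 2 (Nat.card (E e)) : ℝ) : EReal) ≤ cap e)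
    (hrate : ∀ s, rate s ≤ Real.logb 2 (Nat.card (S s))) :
    IsAdmissible G M rate cap := by
  classical
  let x₀ : (s : M.Session) → S s := fun s => Classical.arbitrary _
  let Φ : NetworkCode G M :=
    { srcAlphabet := S
      edgeAlphabet := E
      finiteSrc := inferInstance
      nonemptySrc := inferInstance
      finiteEdge := inferInstance
      nonemptyEdge := inferInstance
      -- Evaluate `F e` at any message tuple consistent with the incident symbols; `hF` makes the
      -- choice irrelevant. Inputs that never occur get the value at `x₀`.
      localFun := fun e u w =>
        if hx : ∃ x : (s : M.Session) → S s, (∀ s : {s // M.origin s = G.tail e}, x s.1 = u s) ∧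
          ∀ f : {f // G.head f = G.tail e}, F f.1 x = w f then F e hx.choose else F e x₀ }
  have hlink : ∀ x e, Φ.linkSymbol x e = F e x := by
    intro x e
    induction e using G.wellFounded.induction with
    | _ e ih =>
      rw [Φ.linkSymbol_eq]
      have hx : ∃ z : (s : M.Session) → S s,
          (∀ s : {s // M.origin s = G.tail e}, z s.1 = x s.1) ∧
          ∀ f : {f // G.head f = G.tail e}, F f.1 z = Φ.linkSymbol x f.1 :=
        ⟨x, fun _ => rfl, fun f => (ih f.1 f.2).symm⟩
      refine (dif_pos hx).trans ?_
      refine hF e _ _ (fun s hs => hx.choose_spec.1 ⟨s, hs⟩) fun f hf => ?_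
      rw [← ih f hf]
      exact hx.choose_spec.2 ⟨f, hf⟩
  refine ⟨Φ, ?_, hcap, hrate⟩
  let δ : Φ.Decoder := fun s d w =>
    if hx : ∃ x : (s : M.Session) → S s, ∀ f : {f // G.head f = d}, F f.1 x = w f then
      hx.choose s else x₀ s
  refine ⟨δ, ?_⟩
  rw [NetworkCode.errorProb, div_eq_zero_iff]
  left
  rw [Nat.cast_eq_zero, Nat.card_eq_zero]
  left
  refine ⟨?_⟩
  rintro ⟨x, s, d, hd, hne⟩
  apply hne
  have hx : ∃ z : (s : M.Session) → S s, ∀ f : {f // G.head f = d},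
      F f.1 z = Φ.linkSymbol x f.1 := ⟨x, fun f => (hlink x f.1).symm⟩
  refine (dif_pos hx).trans (hdec s d hd _ _ fun f hf => ?_)
  rw [← hlink x f]
  exact hx.choose_spec ⟨f, hf⟩

/-! ### The code built from a uniform family -/

/-- Transport addition modulo |B|. This is the mask on W: the upper receiver removes S_[α], the
lower one removes V_α. -/
theorem exists_cancellative_operation (B : Type) [Finite B] [Nonempty B] :
    ∃ op : B → B → B, (∀ a b c, op a b = op a c → b = c) ∧ ∀ a b c, op a c = op b c → a = b := by
  have e := Finite.equivFin B
  have : NeZero (Nat.card B) := ⟨Nat.card_pos.ne'⟩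
  refine ⟨fun a b => e.symm (e a + e b), fun a b c h => ?_, fun a b c h => ?_⟩
  · simpa using h
  · simpa using h

theorem jointRV_eq_iff {Ω : Type} {N : ℕ} {A : Fin N → Type} {V : (i : Fin N) → Ω → A i}
    {α : Finset (Fin N)} {x y : Ω} :
    jointRV V α x = jointRV V α y ↔ ∀ i ∈ α, V i x = V i y := by
  simp [jointRV, funext_iff]

/-- If `k` takes `q` values on every fibre of `f`, then `q` indices suffice to recover `k` from
`f`. -/
theorem exists_fiber_index {Ω B C : Type} [Finite Ω] [Nonempty Ω] (f : Ω → C) (k : Ω → B) (q : ℕ)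
    (hq : ∀ x, Nat.card (k '' {y | f y = f x}) = q) :
    ∃ g : Ω → Fin q, ∀ x y, f x = f y → (g x = g y ↔ k x = k y) := by
  -- The numbering is chosen for the set of values of `k` on a fibre, not for a point, so points of
  -- the same fibre share it.
  have hex : ∀ T : Set B, T.Finite → Nat.card T = q → ∃ i : B → Fin q, Set.InjOn i T := by
    intro T hT hc
    classical
    have x := Classical.arbitrary Ω
    have : Nonempty (k '' {y | f y = f x}) := ⟨⟨k x, x, rfl, rfl⟩⟩
    have : Finite (k '' {y | f y = f x}) := (Set.toFinite _).image _
    have hpos : 0 < q := by rw [← hq x]; exact Nat.card_pos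
    have := hT.to_subtype
    let e := Finite.equivFinOfCardEq hc
    refine ⟨fun b => if hb : b ∈ T then e ⟨b, hb⟩ else ⟨0, hpos⟩, fun a ha b hb hab => ?_⟩
    simpa [ha, hb] using hab
  choose i hi using hex
  refine ⟨fun x => i (k '' {y | f y = f x}) ((Set.toFinite _).image _) (hq x) (k x),
    fun x y hxy => ?_⟩
  have key : ∀ T T' (h : T = T') h1 h1' h2 h2', i T h1 h2 = i T' h1' h2' := by
    rintro T _ rfl _ _ _ _
    rfl
  have hT : k '' {z | f z = f y} = k '' {z | f z = f x} := by rw [hxy]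
  dsimp only
  rw [key _ _ hT _ ((Set.toFinite _).image _) _ (hq x)]
  exact (hi _ ((Set.toFinite _).image _) (hq x)).eq_iff ⟨x, rfl, rfl⟩ ⟨y, hxy.symm, rfl⟩

/-- In a uniform family, `2 ^ (h β - h α)` indices suffice to recover the variables indexed by `β`
from those indexed by a subset `α`. -/
theorem IsUniformFamily.exists_index {N : ℕ} {Ω : Type} [Finite Ω] [Nonempty Ω]
    {A : Fin N → Type} {V : (i : Fin N) → Ω → A i} {h : Finset (Fin N) → ℝ}
    (hV : IsUniformFamily V h) {α β : Finset (Fin N)} (hαβ : α ⊆ β) :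
    ∃ q : ℕ, 0 < q ∧ Real.logb 2 q = h β - h α ∧ ∃ g : Ω → Fin q,
      ∀ x y, jointRV V α x = jointRV V α y → (g x = g y ↔ jointRV V β x = jointRV V β y) := by
  have hΩ : (Nat.card Ω : ℝ) ≠ 0 := by exact_mod_cast Nat.card_pos.ne'
  -- A fibre of V_α has |Ω| / 2^h(α) points and is a union of fibres of V_β with |Ω| / 2^h(β) points
  -- each.
  have hcard : ∀ x, (Nat.card (jointRV V β '' {y | jointRV V α y = jointRV V α x}) : ℝ) =
      2 ^ (h β - h α) := by
    intro x
    have h1 := card_range_mul_of_card_fiber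
      (fun y : {y // jointRV V α y = jointRV V α x} => jointRV V β y.1) (Nat.card Ω / 2 ^ h β) (by
        intro y
        rw [← hV β y.1, mul_div_cancel_right₀ _ (by positivity)]
        congr 1
        exact Nat.card_congr
          { toFun := fun z => ⟨z.1.1, z.2⟩
            invFun := fun z => ⟨⟨z.1, (jointRV_eq_iff.2 fun i hi =>
              jointRV_eq_iff.1 z.2 i (hαβ hi)).trans y.2⟩, z.2⟩
            left_inv := fun _ => rfl
            right_inv := fun _ => rfl })
    have h2 : Set.range (fun y : {y // jointRV V α y = jointRV V α x} => jointRV V β y.1) =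
        jointRV V β '' {y | jointRV V α y = jointRV V α x} := by
      ext b
      simp
    have h3 := hV α x
    rw [h2] at h1
    rw [Real.rpow_sub two_pos]
    have ha : (0 : ℝ) < 2 ^ h α := by positivity
    have hb : (0 : ℝ) < 2 ^ h β := by positivity
    have h4 : (Nat.card {y // jointRV V α y = jointRV V α x} : ℝ) = Nat.card Ω / 2 ^ h α := by
      field_simp
      exact h3
    rw [h4] at h1
    field_simp at h1 ⊢
    exact h1
  have x₀ := Classical.arbitrary Ω
  refine ⟨Nat.card (jointRV V β '' {y | jointRV V α y = jointRV V α x₀}), ?_, ?_,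
    exists_fiber_index _ _ _ fun x => ?_⟩
  · have : (0 : ℝ) < 2 ^ (h β - h α) := by positivity
    rw [← hcard x₀] at this
    exact_mod_cast this
  · rw [hcard, Real.logb_rpow] <;> norm_num
  · have := (hcard x).trans (hcard x₀).symm
    exact_mod_cast this

namespace Dagger

/-- The edge alphabets of the code on `G†` in which the variables indexed by `α` take values in
`R α`; the sets `Fin (q α)` and `Fin (r p)` contain the indices sent on the edges `W'` and `W''`. -/
def Alphabet {N : ℕ} (R : Finset (Fin N) → Type) (q : NE N → ℕ) (r : Pairs N → ℕ) : Edge N → Type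
  | .V j => R {j}
  | .W0 α => R α.1
  | .W1 α => Fin (q α)
  | .in1 _ j => R {j.1}
  | .W1' α => R α.1
  | .in2 _ j => R {j.1}
  | .Wss p => R p.set.1
  | .copyMix p => R p.set.1
  | .copyCompress p => R p.set.1
  | .srcMix p => R p.set.1
  | .srcUpper p => R p.set.1
  | .W p => R p.set.1
  | .forkUpper p => R p.set.1
  | .forkLower p => R p.set.1
  | .W' p => Fin (q p.set)
  | .viCompress p => R {p.elt}
  | .viExpand p => R {p.elt}
  | .W'' p => Fin (r p)
  | .Ws p => R p.set.1

/-- The symbols on the edges of `G†`, as functions of the messages: `P` gives the values of the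
variables, `ω` the outcome that represents the message `S_[N]`, `op` combines `W**` and `S_[α]`,
and `g`, `c` are the indices sent on the edges `W'` and `W''`. -/
def symbol {N : ℕ} {R : Finset (Fin N) → Type} {q : NE N → ℕ} {r : Pairs N → ℕ} {Ω : Type}
    (P : (α : Finset (Fin N)) → Ω → R α) (op : (α : Finset (Fin N)) → R α → R α → R α)
    (g : (α : NE N) → Ω → Fin (q α)) (c : (p : Pairs N) → Ω → Fin (r p))
    (ω : R Finset.univ → Ω) :
    (e : Edge N) → ((α : NE N) → R α.1) → Alphabet R q r e
  | .V j, x => P {j} (ω (x (NE.top ⟨{j}, Finset.singleton_nonempty j⟩)))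
  | .W0 α, x => x α
  | .W1 α, x => g α (ω (x α.top))
  | .in1 α j, x => P {j.1} (ω (x α.top))
  | .W1' α, x => P α.1 (ω (x α.top))
  | .in2 p j, x => P {j.1} (ω (x p.set.top))
  | .Wss p, x => P p.set.1 (ω (x p.set.top))
  | .copyMix p, x => P p.set.1 (ω (x p.set.top))
  | .copyCompress p, x => P p.set.1 (ω (x p.set.top))
  | .srcMix p, x => x p.set
  | .srcUpper p, x => x p.set
  | .W p, x => op p.set.1 (P p.set.1 (ω (x p.set.top))) (x p.set)
  | .forkUpper p, x => op p.set.1 (P p.set.1 (ω (x p.set.top))) (x p.set)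
  | .forkLower p, x => op p.set.1 (P p.set.1 (ω (x p.set.top))) (x p.set)
  | .W' p, x => g p.set (ω (x p.set.top))
  | .viCompress p, x => P {p.elt} (ω (x p.set.top))
  | .viExpand p, x => P {p.elt} (ω (x p.set.top))
  | .W'' p, x => c p (ω (x p.set.top))
  | .Ws p, x => P p.set.1 (ω (x p.set.top))

end Dagger

-- Each source alphabet has exactly 2^h(α) elements, meeting the rate of S_[α] and the capacities
-- h(α) at once; the conditional indices of `exists_index` meet the difference capacities.
open Dagger in
theorem IsUniformFamily.isAdmissible {N : ℕ} {Ω : Type} [Finite Ω] [Nonempty Ω]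
    {A : Fin N → Type} {V : (i : Fin N) → Ω → A i} {h : Finset (Fin N) → ℝ}
    (hV : IsUniformFamily V h) {κ : EReal} (hκ : ((∑ α, h α : ℝ) : EReal) ≤ κ) :
    IsAdmissible (daggerNetwork N) (daggerRequirement N) (inducedRate h)
      (inducedCapacity κ h) := by
  let R : Finset (Fin N) → Type := fun α => Set.range (jointRV V α)
  let P : (α : Finset (Fin N)) → Ω → R α := fun α x => ⟨jointRV V α x, x, rfl⟩
  have hRfin : ∀ α, Finite (R α) := fun α => inferInstanceAs (Finite (Set.range _))
  have hRne : ∀ α, Nonempty (R α) := fun α => inferInstanceAs (Nonempty (Set.range _))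
  have hP : ∀ α x y, P α x = P α y ↔ ∀ i ∈ α, V i x = V i y :=
    fun α x y => Subtype.ext_iff.trans jointRV_eq_iff
  have hP1 : ∀ i x y, P {i} x = P {i} y ↔ V i x = V i y := fun i x y => by simp [hP]
  have hlog : ∀ α, Real.logb 2 (Nat.card (R α)) = h α := by
    intro α
    rw [hV.card_range α, Real.logb_rpow] <;> norm_num
  have hnonneg : ∀ α, 0 ≤ h α := by
    intro α
    rw [← hlog α]
    refine Real.logb_nonneg one_lt_two ?_
    exact_mod_cast Nat.one_le_iff_ne_zero.2 Nat.card_pos.ne'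
  -- Forwarding edges carry single symbols from some `R α`; as all h(α) are nonnegative, the sum
  -- bounds each of them.
  have hle : ∀ α, ((h α : ℝ) : EReal) ≤ κ := fun α => le_trans
    (EReal.coe_le_coe_iff.2 (Finset.single_le_sum (fun β _ => hnonneg β) (Finset.mem_univ α))) hκ
  choose q hq0 hqlog g hg using fun α : NE N => hV.exists_index (Finset.subset_univ α.1)
  choose r hr0 hrlog c hc using fun p : Pairs N => hV.exists_index
    (Finset.singleton_subset_iff.2 (Finset.mem_insert_self p.elt p.set.1))
  choose op hop1 hop2 using fun α => exists_cancellative_operation (R α)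
  have hsurj : ∀ y : R Finset.univ, ∃ x, P Finset.univ x = y := by
    rintro ⟨_, x, rfl⟩
    exact ⟨x, rfl⟩
  choose ω hω using hsurj
  have hE : ∀ e, Finite (Alphabet R q r e) ∧ Nonempty (Alphabet R q r e) := by
    have h1 := fun α => And.intro (hRfin α) (hRne α)
    have h2 := fun α => And.intro (inferInstance : Finite (Fin (q α)))
      (⟨⟨0, hq0 α⟩⟩ : Nonempty (Fin (q α)))
    have h3 := fun p => And.intro (inferInstance : Finite (Fin (r p)))
      (⟨⟨0, hr0 p⟩⟩ : Nonempty (Fin (r p)))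
    intro e
    cases e <;> first | exact h1 _ | exact h2 _ | exact h3 _
  have hg' : ∀ (α : NE N) x y, P α.1 x = P α.1 y → g α x = g α y →
      P Finset.univ x = P Finset.univ y := fun α x y h1 h2 =>
    Subtype.ext ((hg α x y (Subtype.ext_iff.1 h1)).1 h2)
  -- The compressing node can compute W'' from V_i and V_α, and by `hc2` the expanding node can undo
  -- this from V_i and W''.
  have hc1 : ∀ p x y, P {p.elt} x = P {p.elt} y → P p.set.1 x = P p.set.1 y → c p x = c p y := by
    intro p x y h1 h2
    refine (hc p x y (Subtype.ext_iff.1 h1)).2 (jointRV_eq_iff.2 fun i hi => ?_)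
    rcases Finset.mem_insert.1 hi with rfl | hi
    · exact (hP1 _ _ _).1 h1
    · exact (hP _ _ _).1 h2 i hi
  have hc2 : ∀ p x y, P {p.elt} x = P {p.elt} y → c p x = c p y → P p.set.1 x = P p.set.1 y := by
    intro p x y h1 h2
    refine (hP _ _ _).2 fun i hi => ?_
    exact jointRV_eq_iff.1 ((hc p x y (Subtype.ext_iff.1 h1)).1 h2) i (Finset.mem_insert_of_mem hi)
  have htop : ∀ x y : R Finset.univ, P Finset.univ (ω x) = P Finset.univ (ω y) → x = y :=
    fun x y hxy => by rwa [hω, hω] at hxy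
  have hf1 : ∀ e : (daggerNetwork N).Edge, Finite (Alphabet R q r e) := fun e => (hE e).1
  have hf2 : ∀ e : (daggerNetwork N).Edge, Nonempty (Alphabet R q r e) := fun e => (hE e).2
  refine isAdmissible_of_globalFun (G := daggerNetwork N) (M := daggerRequirement N)
    (fun α : NE N => R α.1) (Alphabet R q r) (symbol P op g c ω) ?_ ?_ ?_ ?_
  · intro (e : Edge N) x y hs hf
    have hs' : ∀ α : NE N, Node.source α = tail e → x α = y α := hs
    have hf' : ∀ f : Edge N, head f = tail e → symbol P op g c ω f x = symbol P op g c ω f y := hf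
    clear hs hf
    cases e with
    | V j => exact congrArg (fun z => P {j} (ω z)) (hs' _ rfl)
    | W0 α => exact hs' _ rfl
    | W1 α => exact congrArg (fun z => g α (ω z)) (hs' _ rfl)
    | in1 α j => exact hf' (.V j.1) rfl
    | W1' α => exact (hP _ _ _).2 fun i hi => (hP1 _ _ _).1 (hf' (.in1 α ⟨i, hi⟩) rfl)
    | in2 p j => exact hf' (.V j.1) rfl
    | Wss p => exact (hP _ _ _).2 fun i hi => (hP1 _ _ _).1 (hf' (.in2 p ⟨i, hi⟩) rfl)
    | copyMix p => exact hf' (.Wss p) rfl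
    | copyCompress p => exact hf' (.Wss p) rfl
    | srcMix p => exact hs' _ rfl
    | srcUpper p => exact hs' _ rfl
    | W p => exact congrArg₂ (op p.set.1) (hf' (.copyMix p) rfl) (hf' (.srcMix p) rfl)
    | forkUpper p => exact hf' (.W p) rfl
    | forkLower p => exact hf' (.W p) rfl
    | W' p => exact congrArg (fun z => g p.set (ω z)) (hs' _ rfl)
    | viCompress p => exact hf' (.V p.elt) rfl
    | viExpand p => exact hf' (.V p.elt) rfl
    | W'' p => exact hc1 p _ _ (hf' (.viCompress p) rfl) (hf' (.copyCompress p) rfl)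
    | Ws p => exact hc2 p _ _ (hf' (.viExpand p) rfl) (hf' (.W'' p) rfl)
  · rintro ⟨α, hα⟩ d hd x y hf
    have hf' : ∀ f : Edge N, head f = d → symbol P op g c ω f x = symbol P op g c ω f y := hf
    clear hf
    rcases hd with rfl | ⟨p, hp, rfl⟩ | ⟨rfl, ⟨β, rfl⟩ | ⟨p, rfl⟩⟩
    · exact hf' (.W0 _) rfl
    · obtain rfl : p.1.1 = α := Subtype.ext_iff.1 hp
      have h1 : P _ _ = P _ _ := hf' (.Ws p) rfl
      have h2 : op _ (P _ _) _ = op _ (P _ _) _ := hf' (.forkLower p) rfl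
      rw [h1] at h2
      exact hop1 _ _ _ _ h2
    · exact htop _ _ (hg' β _ _ (hf' (.W1' β) rfl) (hf' (.W1 β) rfl))
    · have h1 : x p.set = y p.set := hf' (.srcUpper p) rfl
      have h2 : op _ (P _ _) (x p.set) = op _ (P _ _) _ := hf' (.forkUpper p) rfl
      rw [h1] at h2
      exact htop _ _ (hg' p.set _ _ (hop2 _ _ _ _ h2) (hf' (.W' p) rfl))
  · have hR : ∀ α, ((Real.logb 2 (Nat.card (R α)) : ℝ) : EReal) ≤ (h α : ℝ) :=
      fun α => EReal.coe_le_coe_iff.2 (hlog α).le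
    have hRκ : ∀ α, ((Real.logb 2 (Nat.card (R α)) : ℝ) : EReal) ≤ κ :=
      fun α => (hR α).trans (hle α)
    have hQ : ∀ α : NE N, ((Real.logb 2 (Nat.card (Fin (q α))) : ℝ) : EReal) ≤
        (h Finset.univ - h α.1 : ℝ) :=
      fun α => EReal.coe_le_coe_iff.2 (by rw [Nat.card_fin, hqlog])
    have hS : ∀ p : Pairs N, ((Real.logb 2 (Nat.card (Fin (r p))) : ℝ) : EReal) ≤
        (h (insert p.elt p.set.1) - h {p.elt} : ℝ) :=
      fun p => EReal.coe_le_coe_iff.2 (by rw [Nat.card_fin, hrlog])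
    intro (e : Edge N)
    cases e with
    | V j => exact hR {j}
    | W0 α => exact hR α.1
    | W1 α => exact hQ α
    | in1 _ j => exact hRκ {j.1}
    | W1' α => exact hR α.1
    | in2 _ j => exact hRκ {j.1}
    | Wss p => exact hR p.set.1
    | copyMix p => exact hRκ p.set.1
    | copyCompress p => exact hRκ p.set.1
    | srcMix p => exact hRκ p.set.1
    | srcUpper p => exact hRκ p.set.1
    | W p => exact hR p.set.1
    | forkUpper p => exact hRκ p.set.1
    | forkLower p => exact hRκ p.set.1
    | W' p => exact hQ p.set
    | viCompress p => exact hRκ {p.elt}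
    | viExpand p => exact hRκ {p.elt}
    | W'' p => exact hS p
    | Ws p => exact hR p.set.1
  · exact fun α : NE N => (hlog α.1).ge

/-! ### Counting lemmas for the converse -/

/-- If a map has at most `t` values, its fibres have at most `q` elements, and its domain has
`t * q` elements, then all the nonempty fibres have exactly `q` elements. -/
theorem card_fiber_eq_of_le {Ω B : Type} [Finite Ω] (f : Ω → B) {t q : ℝ} (hq : 0 ≤ q)
    (hf : (Nat.card (Set.range f) : ℝ) ≤ t) (hfib : ∀ x, (Nat.card {y // f y = f x} : ℝ) ≤ q)
    (hΩ : t * q ≤ Nat.card Ω) (x : Ω) : (Nat.card {y // f y = f x} : ℝ) = q := by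
  classical
  have := Fintype.ofFinite Ω
  have := Fintype.ofFinite (Set.range f)
  have e : ∀ x, Nat.card {y // Set.rangeFactorization f y = Set.rangeFactorization f x} =
      Nat.card {y // f y = f x} := fun x =>
    Nat.card_congr (Equiv.subtypeEquivRight fun y => Subtype.ext_iff)
  have hsum : (∑ b : Set.range f, (Nat.card {y // Set.rangeFactorization f y = b} : ℝ)) =
      Nat.card Ω := by
    rw [← Nat.card_congr (Equiv.sigmaFiberEquiv (Set.rangeFactorization f)), Nat.card_sigma,
      Nat.cast_sum]
  have hle : ∀ b : Set.range f, (Nat.card {y // Set.rangeFactorization f y = b} : ℝ) ≤ q := by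
    rintro ⟨_, x, rfl⟩
    exact (congrArg Nat.cast (e x)).trans_le (hfib x)
  -- The fibre sizes add up to |Ω| ≥ t q, at least q times the number of fibres, so no term bounded
  -- by q can fall short.
  have hge : (∑ b : Set.range f, q) ≤
      ∑ b : Set.range f, (Nat.card {y // Set.rangeFactorization f y = b} : ℝ) := by
    rw [hsum, Finset.sum_const, Finset.card_univ, ← Nat.card_eq_fintype_card, nsmul_eq_mul]
    exact (mul_le_mul_of_nonneg_right hf hq).trans hΩ
  have := (Finset.sum_eq_sum_iff_of_le fun b _ => hle b).1
    (le_antisymm (Finset.sum_le_sum fun b _ => hle b) hge) (Set.rangeFactorization f x)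
    (Finset.mem_univ _)
  rw [← this, e]

/-- A map that factors through `f` and has at least as many values determines `f`. -/
theorem eq_of_card_range_le {Ω B C : Type} [Finite Ω] {f : Ω → B} {g : Ω → C}
    (hfg : ∀ x y, f x = f y → g x = g y)
    (hcard : Nat.card (Set.range f) ≤ Nat.card (Set.range g)) {x y : Ω} (hxy : g x = g y) :
    f x = f y := by
  let φ : Set.range f → Set.range g := fun b => ⟨g b.2.choose, _, rfl⟩
  have hφ : ∀ z, φ ⟨f z, z, rfl⟩ = ⟨g z, z, rfl⟩ := fun z =>
    Subtype.ext (hfg _ _ (⟨z, rfl⟩ : f z ∈ Set.range f).choose_spec)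
  have hsurj : Function.Surjective φ := by
    rintro ⟨_, z, rfl⟩
    exact ⟨_, hφ z⟩
  have hbij := hsurj.bijective_of_nat_card_le hcard
  have : (⟨f x, x, rfl⟩ : Set.range f) = ⟨f y, y, rfl⟩ :=
    hbij.1 (by rw [hφ, hφ]; exact Subtype.ext hxy)
  exact Subtype.ext_iff.1 this

/-- The combinatorial content of a type 2 subnetwork. The symbol `w` combines a function of `v` with
an independent source in `T`; it reveals `v` to a receiver that knows the source, and it reveals the
source to a receiver that knows `z`. If the alphabets are as small as possible, `z` determines
`v`. -/
theorem eq_of_masked_eq {Ω T B D E F : Type} [Finite Ω] [Finite T] [Nonempty T]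
    [Finite D] [Finite E] {t k : ℝ} (hk : 0 < k) {v : Ω → B} {w : Ω → T → D} {e : Ω → T → E}
    {z : Ω → F} (hvw : ∀ a b τ, v a = v b → w a τ = w b τ)
    (hv : (Nat.card (Set.range v) : ℝ) ≤ t) (hT : t ≤ Nat.card T) (hD : (Nat.card D : ℝ) ≤ t)
    (hE : (Nat.card E : ℝ) ≤ k) (hΩ : t * k ≤ Nat.card Ω)
    (hup : ∀ a b τ, w a τ = w b τ → e a τ = e b τ → a = b)
    (hlow : ∀ a b τ σ, w a τ = w b σ → z a = z b → τ = σ) {a b : Ω} (hab : z a = z b) :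
    v a = v b := by
  have τ := Classical.arbitrary T
  -- With the source fixed at τ, `w` and `e` identify the outcome; since `e` has at most k values,
  -- `w · τ` has at least t, as many as `v` can have.
  have h1 : Nat.card Ω ≤ Nat.card (Set.range fun x => w x τ) * Nat.card E := by
    rw [← Nat.card_prod]
    refine Nat.card_le_card_of_injective
      (fun x => ((⟨w x τ, x, rfl⟩ : Set.range fun x => w x τ), e x τ)) fun x y hxy => ?_
    simp only [Prod.mk.injEq] at hxy
    exact hup _ _ τ (Subtype.ext_iff.1 hxy.1) hxy.2
  have h2 : t ≤ Nat.card (Set.range fun x => w x τ) := by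
    have h1' : (Nat.card Ω : ℝ) ≤ Nat.card (Set.range fun x => w x τ) * Nat.card E := by
      exact_mod_cast h1
    have h3 : (Nat.card (Set.range fun x => w x τ) : ℝ) * Nat.card E ≤
        Nat.card (Set.range fun x => w x τ) * k :=
      mul_le_mul_of_nonneg_left hE (Nat.cast_nonneg _)
    exact le_of_mul_le_mul_right (hΩ.trans (h1'.trans h3)) hk
  have h4 : Nat.card (Set.range v) ≤ Nat.card (Set.range fun x => w x τ) := by
    exact_mod_cast hv.trans h2
  refine eq_of_card_range_le (g := fun x => w x τ) (fun x y => hvw x y τ) h4 ?_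
  -- For fixed `a` the source is recovered from `w`, and `D` is no larger than `T`, so `w a` attains
  -- every symbol of `D`.
  have hinj : Function.Injective (w a) := fun σ σ' h => hlow a a σ σ' h rfl
  have hsurj : Function.Surjective (w a) :=
    (hinj.bijective_of_nat_card_le (by exact_mod_cast hD.trans hT)).2
  -- Some σ makes `a` imitate the symbol of (b, τ). Since `z` agrees on `a` and `b`, decoding forces
  -- σ = τ; hence `w a τ = w b τ`, which determines `v`.
  obtain ⟨σ, hσ⟩ := hsurj (w b τ)
  obtain rfl := hlow a b σ τ hσ hab
  exact hσ

theorem natCard_le_rpow_of_logb_le {B : Type} [Finite B] [Nonempty B] {c : ℝ}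
    (h : ((Real.logb 2 (Nat.card B) : ℝ) : EReal) ≤ (c : EReal)) : (Nat.card B : ℝ) ≤ 2 ^ c := by
  rw [EReal.coe_le_coe_iff] at h
  exact (Real.logb_le_iff_le_rpow one_lt_two (by exact_mod_cast Nat.card_pos)).1 h

/-! ### Dependence of symbols and decoding in the network G† -/

namespace Dagger

variable {N : ℕ} (Φ : NetworkCode (daggerNetwork N) (daggerRequirement N)) {x y : Φ.Messages}

theorem linkSymbol_congr {e : Edge N} (hs : ∀ s : NE N, Node.source s = tail e → x s = y s)
    (hf : ∀ f : Edge N, head f = tail e → Φ.linkSymbol x f = Φ.linkSymbol y f) :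
    Φ.linkSymbol x e = Φ.linkSymbol y e :=
  Φ.linkSymbol_congr hs hf

/-- No edge enters a source node, and only one session originates there. -/
theorem linkSymbol_congr_source {e : Edge N} {s : NE N} (he : tail e = Node.source s)
    (hs : x s = y s) : Φ.linkSymbol x e = Φ.linkSymbol y e := by
  refine linkSymbol_congr Φ (fun s' hs' => ?_) fun f hf => ?_
  · obtain rfl := Node.source.inj (hs'.trans he)
    exact hs
  · rw [he] at hf
    cases f <;> simp [head] at hf

theorem linkSymbol_congr_inner {e : Edge N} (he : ∀ s, tail e ≠ Node.source s)
    (hf : ∀ f : Edge N, head f = tail e → Φ.linkSymbol x f = Φ.linkSymbol y f) :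
    Φ.linkSymbol x e = Φ.linkSymbol y e :=
  linkSymbol_congr Φ (fun s hs => absurd hs.symm (he s)) hf

/-- The symbol on the edge `V_j` as a function of the message `S_[N]`. -/
theorem linkSymbol_V {s : NE N} (hs : s.1 = Finset.univ) (h : x s = y s) (j : Fin N) :
    Φ.linkSymbol x (Edge.V j) = Φ.linkSymbol y (Edge.V j) := by
  obtain ⟨s, hs'⟩ := s
  obtain rfl : s = Finset.univ := hs
  exact linkSymbol_congr_source Φ rfl h

theorem linkSymbol_W1' {α : NE N}
    (h : ∀ j ∈ α.1, Φ.linkSymbol x (Edge.V j) = Φ.linkSymbol y (Edge.V j)) :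
    Φ.linkSymbol x (Edge.W1' α) = Φ.linkSymbol y (Edge.W1' α) := by
  refine linkSymbol_congr_inner Φ (by simp [tail]) fun f hf => ?_
  -- Only the edges `in1 α j` enter the intermediate node, and each leaves a node whose only
  -- incoming edge is `V j`.
  cases f <;> simp [head, tail] at hf
  subst hf
  rename_i j
  refine linkSymbol_congr_inner Φ (by simp [tail]) fun f hf => ?_
  cases f <;> simp [head, tail] at hf
  subst hf
  exact h _ j.2

theorem linkSymbol_Wss {p : Pairs N}
    (h : ∀ j ∈ p.set.1, Φ.linkSymbol x (Edge.V j) = Φ.linkSymbol y (Edge.V j)) :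
    Φ.linkSymbol x (Edge.Wss p) = Φ.linkSymbol y (Edge.Wss p) := by
  refine linkSymbol_congr_inner Φ (by simp [tail]) fun f hf => ?_
  cases f <;> simp [head, tail] at hf
  subst hf
  rename_i j
  refine linkSymbol_congr_inner Φ (by simp [tail]) fun f hf => ?_
  cases f <;> simp [head, tail] at hf
  subst hf
  exact h _ j.2

theorem linkSymbol_W {p : Pairs N}
    (h : Φ.linkSymbol x (Edge.Wss p) = Φ.linkSymbol y (Edge.Wss p)) (hs : x p.set = y p.set) :
    Φ.linkSymbol x (Edge.W p) = Φ.linkSymbol y (Edge.W p) := by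
  refine linkSymbol_congr_inner Φ (by simp [tail]) fun f hf => ?_
  cases f <;> simp [head, tail] at hf
  · subst hf
    refine linkSymbol_congr_inner Φ (by simp [tail]) fun f hf => ?_
    cases f <;> simp [head, tail] at hf
    subst hf
    exact h
  · subst hf
    exact linkSymbol_congr_source Φ rfl hs

theorem linkSymbol_W'' {p : Pairs N}
    (h : Φ.linkSymbol x (Edge.Wss p) = Φ.linkSymbol y (Edge.Wss p))
    (hi : Φ.linkSymbol x (Edge.V p.elt) = Φ.linkSymbol y (Edge.V p.elt)) :
    Φ.linkSymbol x (Edge.W'' p) = Φ.linkSymbol y (Edge.W'' p) := by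
  refine linkSymbol_congr_inner Φ (by simp [tail]) fun f hf => ?_
  cases f <;> simp [head, tail] at hf
  · subst hf
    refine linkSymbol_congr_inner Φ (by simp [tail]) fun f hf => ?_
    cases f <;> simp [head, tail] at hf
    subst hf
    exact h
  · subst hf
    refine linkSymbol_congr_inner Φ (by simp [tail]) fun f hf => ?_
    cases f <;> simp [head, tail] at hf
    subst hf
    exact hi

theorem linkSymbol_Ws {p : Pairs N}
    (h : Φ.linkSymbol x (Edge.W'' p) = Φ.linkSymbol y (Edge.W'' p))
    (hi : Φ.linkSymbol x (Edge.V p.elt) = Φ.linkSymbol y (Edge.V p.elt)) :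
    Φ.linkSymbol x (Edge.Ws p) = Φ.linkSymbol y (Edge.Ws p) := by
  refine linkSymbol_congr_inner Φ (by simp [tail]) fun f hf => ?_
  cases f <;> simp [head, tail] at hf
  · subst hf
    refine linkSymbol_congr_inner Φ (by simp [tail]) fun f hf => ?_
    cases f <;> simp [head, tail] at hf
    subst hf
    exact hi
  · subst hf
    exact h

variable {Φ}

theorem decode_sink0 (hΦ : Φ.IsZeroError) {α : NE N}
    (h : Φ.linkSymbol x (Edge.W0 α) = Φ.linkSymbol y (Edge.W0 α)) : x α = y α := by
  refine hΦ.eq_of_linkSymbol_eq (s := α) (d := Node.sink0 α) (Or.inl rfl) ?_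
  intro (f : Edge N) (hf : head f = _)
  cases f <;> simp [head] at hf
  subst hf
  exact h

theorem decode_sink1 (hΦ : Φ.IsZeroError) {s α : NE N} (hs : s.1 = Finset.univ)
    (h : Φ.linkSymbol x (Edge.W1 α) = Φ.linkSymbol y (Edge.W1 α))
    (h' : Φ.linkSymbol x (Edge.W1' α) = Φ.linkSymbol y (Edge.W1' α)) : x s = y s := by
  refine hΦ.eq_of_linkSymbol_eq (s := s) (d := Node.sink1 α)
    (Or.inr (Or.inr ⟨hs, Or.inl ⟨α, rfl⟩⟩)) ?_
  intro (f : Edge N) (hf : head f = _)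
  cases f <;> simp [head] at hf
  · subst hf
    exact h
  · subst hf
    exact h'

theorem decode_upper (hΦ : Φ.IsZeroError) {s : NE N} {p : Pairs N} (hs : s.1 = Finset.univ)
    (h : x p.set = y p.set) (hW : Φ.linkSymbol x (Edge.W p) = Φ.linkSymbol y (Edge.W p))
    (hW' : Φ.linkSymbol x (Edge.W' p) = Φ.linkSymbol y (Edge.W' p)) : x s = y s := by
  refine hΦ.eq_of_linkSymbol_eq (s := s) (d := Node.upper p)
    (Or.inr (Or.inr ⟨hs, Or.inr ⟨p, rfl⟩⟩)) ?_
  intro (f : Edge N) (hf : head f = _)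
  cases f <;> simp [head] at hf
  · subst hf
    exact linkSymbol_congr_source Φ rfl h
  · subst hf
    refine linkSymbol_congr_inner Φ (by simp [tail]) fun f hf => ?_
    cases f <;> simp [head, tail] at hf
    subst hf
    exact hW
  · subst hf
    exact hW'

theorem decode_lower (hΦ : Φ.IsZeroError) {p : Pairs N}
    (hW : Φ.linkSymbol x (Edge.W p) = Φ.linkSymbol y (Edge.W p))
    (hWs : Φ.linkSymbol x (Edge.Ws p) = Φ.linkSymbol y (Edge.Ws p)) : x p.set = y p.set := by
  refine hΦ.eq_of_linkSymbol_eq (s := p.set) (d := Node.lower p)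
    (Or.inr (Or.inl ⟨p, rfl, rfl⟩)) ?_
  intro (f : Edge N) (hf : head f = _)
  cases f <;> simp [head] at hf
  · subst hf
    refine linkSymbol_congr_inner Φ (by simp [tail]) fun f hf => ?_
    cases f <;> simp [head, tail] at hf
    subst hf
    exact hW
  · subst hf
    exact hWs

end Dagger

/-! ### The converse: a zero-error code yields a uniform family -/

/-- Independence of the sources enters here: one symbol varies over its whole alphabet while the
others are frozen. -/
theorem NetworkCode.exists_update {G : Network} {M : ConnectionRequirement G}
    (Φ : NetworkCode G M) (x : Φ.Messages) (s : M.Session) (τ : Φ.srcAlphabet s) :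
    ∃ y : Φ.Messages, y s = τ ∧ ∀ s' ≠ s, y s' = x s' := by
  classical
  exact ⟨Function.update x s τ, Function.update_self _ _ _,
    fun s' hs' => Function.update_of_ne hs' _ _⟩

namespace Dagger

variable {N : ℕ} {h : Finset (Fin N) → ℝ} {κ : EReal}
  {Φ : NetworkCode (daggerNetwork N) (daggerRequirement N)}

/-- The type 0 receiver sees only `W0 α`, so this edge distinguishes all values of S_[α]. -/
theorem card_src_le (hΦ : Φ.IsZeroError)
    (hcap : ∀ e, ((Real.logb 2 (Nat.card (Φ.edgeAlphabet e)) : ℝ) : EReal) ≤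
      inducedCapacity κ h e) (α : NE N) :
    (Nat.card (Φ.srcAlphabet α) : ℝ) ≤ 2 ^ h α.1 := by
  classical
  have : ∀ s : NE N, Finite (Φ.srcAlphabet s) := Φ.finiteSrc
  have : ∀ s : NE N, Nonempty (Φ.srcAlphabet s) := Φ.nonemptySrc
  have : ∀ e : Edge N, Finite (Φ.edgeAlphabet e) := Φ.finiteEdge
  have : ∀ e : Edge N, Nonempty (Φ.edgeAlphabet e) := Φ.nonemptyEdge
  let x₀ : Φ.Messages := fun s => (Φ.nonemptySrc s).some
  refine le_trans ?_ (natCard_le_rpow_of_logb_le (hcap (Edge.W0 α)))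
  choose m hm _ using Φ.exists_update x₀ α
  have hinj : Function.Injective fun τ => Φ.linkSymbol (m τ) (Edge.W0 α) := by
    intro τ σ hτσ
    rw [← hm τ, ← hm σ]
    exact decode_sink0 hΦ hτσ
  exact_mod_cast Nat.card_le_card_of_injective _ hinj

/-- In a zero-error code on `G†` the symbols on the edges `V_j`, as functions of the message
`S_[N]`, take at most `2 ^ h α` joint values, for every nonempty `α`. -/
theorem card_range_jointRV_le (hΦ : Φ.IsZeroError)
    (hcap : ∀ e, ((Real.logb 2 (Nat.card (Φ.edgeAlphabet e)) : ℝ) : EReal) ≤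
      inducedCapacity κ h e)
    (hrate : ∀ s, inducedRate h s ≤ Real.logb 2 (Nat.card (Φ.srcAlphabet s)))
    {Ω : Type} [Finite Ω] {s : NE N} (hs : s.1 = Finset.univ) (m : Ω → Φ.Messages)
    (hm : ∀ a b, m a s = m b s → a = b) (hΩ : (2 : ℝ) ^ h Finset.univ ≤ Nat.card Ω)
    {α : Finset (Fin N)} (hα : α.Nonempty) :
    (Nat.card (Set.range (jointRV (fun j a => Φ.linkSymbol (m a) (Edge.V j)) α)) : ℝ) ≤
      2 ^ h α := by
  classical
  have : ∀ s : NE N, Finite (Φ.srcAlphabet s) := Φ.finiteSrc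
  have : ∀ s : NE N, Nonempty (Φ.srcAlphabet s) := Φ.nonemptySrc
  have : ∀ e : Edge N, Finite (Φ.edgeAlphabet e) := Φ.finiteEdge
  have : ∀ e : Edge N, Nonempty (Φ.edgeAlphabet e) := Φ.nonemptyEdge
  have hrate' : ∀ s : NE N, (2 : ℝ) ^ h s.1 ≤ Nat.card (Φ.srcAlphabet s) := fun s =>
    (Real.le_logb_iff_rpow_le one_lt_two (by exact_mod_cast Nat.card_pos)).1 (hrate s)
  induction hα using Finset.Nonempty.cons_induction with
  | singleton j =>
    refine le_trans ?_ (natCard_le_rpow_of_logb_le (hcap (Edge.V j)))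
    have hinj : Function.Injective
        fun b : Set.range (jointRV (fun j a => Φ.linkSymbol (m a) (Edge.V j)) {j}) =>
          b.1 ⟨j, Finset.mem_singleton_self j⟩ := by
      rintro ⟨_, x, rfl⟩ ⟨_, y, rfl⟩ hxy
      refine Subtype.ext ((jointRV_eq_iff
        (V := fun j a => Φ.linkSymbol (m a) (Edge.V j))).2 fun i hi => ?_)
      obtain rfl := Finset.mem_singleton.1 hi
      exact hxy
    exact_mod_cast Nat.card_le_card_of_injective _ hinj
  | cons i α hi hα ih =>
    rw [Finset.cons_eq_insert]
    let p : Pairs N := ⟨(α, i), hα, hi⟩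
    -- As i ∉ α, the sessions S_[α] and S_[N] differ; S_[α] can serve as the mask τ without
    -- disturbing the V_j or W''.
    have hps : s ≠ p.set := by
      rintro rfl
      have hα' : α = Finset.univ := hs
      exact hi (hα' ▸ Finset.mem_univ i)
    choose m' hm'p hm's using fun a => Φ.exists_update (m a) p.set
    replace hm's : ∀ a τ, m' a τ s = m a s := fun a τ => hm's a τ s hps
    have hV : ∀ a τ j, Φ.linkSymbol (m' a τ) (Edge.V j) = Φ.linkSymbol (m a) (Edge.V j) :=
      fun a τ j => linkSymbol_V Φ hs (hm's a τ) j
    have hWss : ∀ a b τ, jointRV (fun j a => Φ.linkSymbol (m a) (Edge.V j)) α a =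
        jointRV (fun j a => Φ.linkSymbol (m a) (Edge.V j)) α b →
        Φ.linkSymbol (m' a τ) (Edge.Wss p) = Φ.linkSymbol (m' b τ) (Edge.Wss p) := by
      intro a b τ hab
      refine linkSymbol_Wss Φ fun j hj => ?_
      rw [hV, hV]
      exact jointRV_eq_iff.1 hab j hj
    have hW'' : ∀ a τ, Φ.linkSymbol (m' a τ) (Edge.W'' p) = Φ.linkSymbol (m a) (Edge.W'' p) :=
      fun a τ => linkSymbol_W'' Φ (linkSymbol_Wss Φ fun j _ => hV a τ j) (hV a τ _)
    -- The pair (V_i, W'') determines W*, hence all that the lower receiver sees besides W, so it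
    -- plays the role of `z`.
    have hdet : ∀ a b, (Φ.linkSymbol (m a) (Edge.V i), Φ.linkSymbol (m a) (Edge.W'' p)) =
        (Φ.linkSymbol (m b) (Edge.V i), Φ.linkSymbol (m b) (Edge.W'' p)) →
        jointRV (fun j a => Φ.linkSymbol (m a) (Edge.V j)) α a =
        jointRV (fun j a => Φ.linkSymbol (m a) (Edge.V j)) α b := by
      intro a b hab
      refine eq_of_masked_eq (k := 2 ^ (h Finset.univ - h α))
        (w := fun a τ => Φ.linkSymbol (m' a τ) (Edge.W p))
        (e := fun a τ => Φ.linkSymbol (m' a τ) (Edge.W' p))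
        (z := fun a => (Φ.linkSymbol (m a) (Edge.V i), Φ.linkSymbol (m a) (Edge.W'' p)))
        (by positivity) ?_ ih (hrate' p.set) (natCard_le_rpow_of_logb_le (hcap (Edge.W p)))
        (natCard_le_rpow_of_logb_le (hcap (Edge.W' p))) ?_ ?_ ?_ hab
      · intro a b τ hab
        exact linkSymbol_W Φ (hWss a b τ hab) (by rw [hm'p, hm'p])
      · rw [← Real.rpow_add two_pos, add_sub_cancel]
        exact hΩ
      · intro a b τ h1 h2
        refine hm a b ?_
        have := decode_upper hΦ hs (by rw [hm'p, hm'p]) h1 h2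
        rwa [hm's, hm's] at this
      · intro a b τ σ h1 h2
        have h3 : Φ.linkSymbol (m' a τ) (Edge.V i) = Φ.linkSymbol (m' b σ) (Edge.V i) := by
          rw [hV, hV]
          exact congrArg Prod.fst h2
        have h4 : Φ.linkSymbol (m' a τ) (Edge.W'' p) = Φ.linkSymbol (m' b σ) (Edge.W'' p) := by
          rw [hW'', hW'']
          exact congrArg Prod.snd h2
        have := decode_lower hΦ h1 (linkSymbol_Ws Φ h4 h3)
        rwa [hm'p, hm'p] at this
    have hinj : Function.Injective
        fun b : Set.range (jointRV (fun j a => Φ.linkSymbol (m a) (Edge.V j)) (insert i α)) =>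
          (Φ.linkSymbol (m b.2.choose) (Edge.V i), Φ.linkSymbol (m b.2.choose) (Edge.W'' p)) := by
      intro b b' hbb'
      refine Subtype.ext (b.2.choose_spec.symm.trans (Eq.trans ?_ b'.2.choose_spec))
      refine jointRV_eq_iff.2 fun j hj => ?_
      rcases Finset.mem_insert.1 hj with rfl | hj
      · exact congrArg Prod.fst hbb'
      · exact jointRV_eq_iff.1 (hdet _ _ hbb') j hj
    have h1 := Nat.card_le_card_of_injective _ hinj
    rw [Nat.card_prod] at h1
    have h2 : (Nat.card (Φ.edgeAlphabet (Edge.V i)) : ℝ) ≤ 2 ^ h {i} :=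
      natCard_le_rpow_of_logb_le (hcap (Edge.V i))
    have h3 : (Nat.card (Φ.edgeAlphabet (Edge.W'' p)) : ℝ) ≤ 2 ^ (h (insert i α) - h {i}) :=
      natCard_le_rpow_of_logb_le (hcap (Edge.W'' p))
    calc _ ≤ (Nat.card (Φ.edgeAlphabet (Edge.V i)) : ℝ) *
          Nat.card (Φ.edgeAlphabet (Edge.W'' p)) := by exact_mod_cast h1
      _ ≤ 2 ^ h {i} * 2 ^ (h (insert i α) - h {i}) :=
          mul_le_mul h2 h3 (Nat.cast_nonneg _) (by positivity)
      _ = _ := by rw [← Real.rpow_add two_pos, add_sub_cancel]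

end Dagger

open Dagger in
theorem mem_quasiUniformEntropyFunctions_of_isAdmissible {N : ℕ} {h : Finset (Fin N) → ℝ}
    (h_empty : h ∅ = 0) {κ : EReal}
    (hadm : IsAdmissible (daggerNetwork N) (daggerRequirement N) (inducedRate h)
      (inducedCapacity κ h)) :
    h ∈ quasiUniformEntropyFunctions N := by
  classical
  -- For N = 0 there is no session S_[N]; a one-point set serves, because h(∅) = 0.
  rcases Nat.eq_zero_or_pos N with rfl | hN
  · refine IsUniformFamily.mem_quasiUniformEntropyFunctions (Ω := Unit) (A := fun _ => Unit)
      (V := fun _ _ => ()) fun α x => ?_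
    rw [Finset.eq_empty_of_isEmpty α, h_empty]
    simp
  obtain ⟨Φ, hΦ, hcap, hrate⟩ := hadm
  have : ∀ s : NE N, Finite (Φ.srcAlphabet s) := Φ.finiteSrc
  have : ∀ s : NE N, Nonempty (Φ.srcAlphabet s) := Φ.nonemptySrc
  have : ∀ e : Edge N, Finite (Φ.edgeAlphabet e) := Φ.finiteEdge
  have : ∀ e : Edge N, Nonempty (Φ.edgeAlphabet e) := Φ.nonemptyEdge
  let s : NE N := ⟨Finset.univ, ⟨⟨0, hN⟩, Finset.mem_univ _⟩⟩
  let x₀ : Φ.Messages := fun s => (Φ.nonemptySrc s).some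
  choose m hms _ using Φ.exists_update x₀ s
  have hm : ∀ a b, m a s = m b s → a = b := fun a b hab => by rwa [hms, hms] at hab
  have hΩ : (2 : ℝ) ^ h Finset.univ ≤ Nat.card (Φ.srcAlphabet s) :=
    (Real.le_logb_iff_rpow_le one_lt_two (by exact_mod_cast Nat.card_pos)).1 (hrate s)
  have hΩ' : (Nat.card (Φ.srcAlphabet s) : ℝ) = 2 ^ h Finset.univ :=
    le_antisymm (card_src_le hΦ hcap s) hΩ
  have hfin : ∀ i : Fin N, Finite (Φ.edgeAlphabet (Edge.V i)) := fun i => Φ.finiteEdge _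
  refine IsUniformFamily.mem_quasiUniformEntropyFunctions (Ω := Φ.srcAlphabet s)
    (A := fun i => Φ.edgeAlphabet (Edge.V i))
    (V := fun j a => Φ.linkSymbol (m a) (Edge.V j)) fun α a => ?_
  -- No subnetwork belongs to α = ∅; its only fibre is the whole set, in agreement with h(∅) = 0.
  rcases Finset.eq_empty_or_nonempty α with rfl | hα
  · rw [h_empty, Real.rpow_zero, mul_one]
    exact congrArg Nat.cast (Nat.card_congr (Equiv.subtypeUnivEquiv fun b =>
      jointRV_eq_iff.2 fun i hi => absurd hi (Finset.notMem_empty i)))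
  -- The bound t on the number of values comes from type 2, the bound q on the fibres from type 1,
  -- and t q = |Ω| leaves no slack.
  · rw [card_fiber_eq_of_le (t := 2 ^ h α) (q := 2 ^ (h Finset.univ - h α)) _ (by positivity)
      (card_range_jointRV_le hΦ hcap hrate (s := s) rfl m hm hΩ hα) ?_ ?_, hΩ',
      ← Real.rpow_add two_pos, sub_add_cancel]
    · intro a
      refine le_trans ?_ (natCard_le_rpow_of_logb_le (hcap (Edge.W1 ⟨α, hα⟩)))
      have hinj : Function.Injective fun b : {b // jointRV
          (fun j a => Φ.linkSymbol (m a) (Edge.V j)) α b =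
          jointRV (fun j a => Φ.linkSymbol (m a) (Edge.V j)) α a} =>
          Φ.linkSymbol (m b.1) (Edge.W1 ⟨α, hα⟩) := by
        intro b b' hbb'
        exact Subtype.ext (hm _ _ (decode_sink1 hΦ rfl hbb'
          (linkSymbol_W1' Φ (jointRV_eq_iff.1 (b.2.trans b'.2.symm)))))
      exact_mod_cast Nat.card_le_card_of_injective _ hinj
    · rw [hΩ', ← Real.rpow_add two_pos, add_sub_cancel]

theorem theorem1 (N : ℕ) (h : Finset (Fin N) → ℝ) (h_empty : h ∅ = 0)
    (κ : EReal) (hκ : ((∑ α, h α : ℝ) : EReal) ≤ κ) :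
    IsAdmissible (daggerNetwork N) (daggerRequirement N) (inducedRate h) (inducedCapacity κ h) ↔
      h ∈ quasiUniformEntropyFunctions N := by
  refine ⟨mem_quasiUniformEntropyFunctions_of_isAdmissible h_empty, fun hh => ?_⟩
  obtain ⟨Ω, A, V, _, _, hV⟩ := exists_isUniformFamily hh
  exact hV.isAdmissible hκ
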